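/- Let $\mathrm{Cat}(\mathcal C)$ denote the category of internal categories in $\mathcal C$, an internal category being identified with its nerve, i.e. with a simplicial object $X$ in $\mathcal C$ all of whose Segal maps $X_k\to X_1\times_{X_0}\cdots\times_{X_0}X_1$ ($k\ge 2$) are isomorphisms. Put $\mathrm{Cat}^0=\mathrm{Set}$ and $\mathrm{Cat}^n=\mathrm{Cat}(\mathrm{Cat}^{n-1})$, the category of $n$-fold categories, with multinerve $N_{(n)}:\mathrm{Cat}^n\to[(\Delta^{op})^n,\mathrm{Set}]$. For $X\in\mathrm{Cat}^n$ and $s\ge 0$ write $X_s\in\mathrm{Cat}^{n-1}$ for the value at $s$ in the first simplicial direction, and let $\xi_nX\in\mathrm{Cat}(\mathrm{Cat}^{n-1})$ be $X$ regarded as an internal category along its last simplicial direction: $(\xi_nX)_r(k_1,\dots,k_{n-1})=X(k_1,\dots,k_{n-1},r)$. Let $p:\mathrm{Cat}\to\mathrm{Set}$ send a category to its set of isomorphism classes of objects. An equivalence relation is a groupoid equivalent to a discrete category. (a) The full subcategory $\mathrm{Cat}^n_{hd}\subset\mathrm{Cat}^n$ of homotopically discrete $n$-fold categories is defined inductively.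 $\mathrm{Cat}^1_{hd}$ consists of the equivalence relations. For $n\ge2$, $X\in\mathrm{Cat}^n$ (so the Segal maps of the simplicial object $s\mapsto X_s$ are isomorphisms) lies in $\mathrm{Cat}^n_{hd}$ if $X_s\in\mathrm{Cat}^{n-1}_{hd}$ for all $s\ge0$ and the $(n-1)$-fold simplicial set $(s_1,\dots,s_{n-1})\mapsto p(X_{s_1\dots s_{n-1}})$ is (isomorphic to) the multinerve of an object $p^{(n)}X$ of $\mathrm{Cat}^{n-1}_{hd}$. (b) For a morphism $f:A\to B$ in a category with pullbacks, let $A[f]$ be the internal category with object of objects $A$, object of arrows $A\times_BA$, source and target the two projections, identities the diagonal, and composition $m$ determined by $p_1m=p_1\pi_1$, $p_2m=p_2\pi_2$. The full subcategory $\mathrm{EqR}^n\subset\mathrm{Cat}^n$ of $n$-equivalence relations is defined inductively. $\mathrm{EqR}^1$ consists of the equivalence relations. For $n\ge2$, $X\in\mathrm{Cat}^n$ lies in $\mathrm{EqR}^n$ if $\xi_nX\cong A[f]$ for some morphism $f:A\to Y$ in $\mathrm{Cat}^{n-1}$ such that $Y\in\mathrm{EqR}^{n-1}$ and $N_{(n-1)}f$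 is levelwise surjective. Theorem. For every $n\ge1$ there is an isomorphism of categories $\mathrm{EqR}^n\cong\mathrm{Cat}^n_{hd}$, compatible with the inclusions of both into $\mathrm{Cat}^n$. -/

import Mathlib

open CategoryTheory Opposite

universe u v w

noncomputable section

namespace NFold

/-! ### Internal categories, presented by their nerves -/

/-- The `j`-th map `ν_j : X_k ⟶ X_1`, induced by `[1] → [k]`, `0 ↦ j`, `1 ↦ j + 1`
(numbering the `j` from `0`). -/
def nu {C : Type w} [Category.{v} C] (X : SimplicialObject C) {k : ℕ} (j : Fin k) :
    X.obj (op (.mk k)) ⟶ X.obj (op (.mk 1)) :=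
  X.map (SimplexCategory.mkOfSucc j).op

/-- All the Segal maps of the simplicial object `X` are isomorphisms: for every `k ≥ 2` the maps
`ν_1, …, ν_k` exhibit `X_k` as the limit `X_1 ×_{X_0} ⋯ ×_{X_0} X_1` (`k` factors) of the zigzag
formed by `d_0, d_1 : X_1 ⟶ X_0`. Here `k` is written as `m + 2`. -/
def IsSegal (C : Type w) [Category.{v} C] : ObjectProperty (SimplicialObject C) := fun X =>
  ∀ (m : ℕ) (T : C) (g : Fin (m + 2) → (T ⟶ X.obj (op (.mk 1)))),
    (∀ i : Fin (m + 1), g i.castSucc ≫ X.δ (0 : Fin 2) = g i.succ ≫ X.δ (1 : Fin 2)) →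
    ∃! h : T ⟶ X.obj (op (.mk (m + 2))), ∀ j : Fin (m + 2), h ≫ nu X j = g j

/-- The category `Cat(C)` of internal categories and internal functors in `C`. An internal category
is given by its nerve: a simplicial object in `C` all of whose Segal maps are isomorphisms, with
`X_0` the object of objects, `X_1` the object of arrows, `d_1` the source, `d_0` the target, `s_0`
the identities, and `d_1 : X_2 = X_1 ×_{X_0} X_1 ⟶ X_1` the composition. -/
abbrev IntCat (C : Type w) [Category.{v} C] := (IsSegal C).FullSubcategory

/-- The internal category `R` in `C` is (up to isomorphism) the internal equivalence relation
`A[f]` of `f : A ⟶ B`: its object of objects is `A`, its object of arrows is `A ×_B A`, and its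
source and target maps are the two projections. As the projections are jointly
monic, the identities are then given by the diagonal of `A`, and the composition
`m : (A ×_B A) ×_A (A ×_B A) ⟶ A ×_B A` is the one with `p_1 m = p_1 π_1`, `p_2 m = p_2 π_2`. -/
def IsInternalEqRel {C : Type w} [Category.{v} C] {A B : C} (f : A ⟶ B) (R : IntCat C) : Prop :=
  ∃ e : R.obj.obj (op (.mk 0)) ≅ A,
    IsPullback (R.obj.δ (1 : Fin 2) ≫ e.hom) (R.obj.δ (0 : Fin 2) ≫ e.hom) f f

/-! ### `n`-fold simplicial sets and `n`-fold categories -/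

/-- The category of `n`-fold simplicial sets `[(Δᵒᵖ)ⁿ, Set]`, regarded as simplicial objects (in the
first direction) in `(n - 1)`-fold simplicial sets. -/
def NSSet : ℕ → Cat.{u, u + 1}
  | 0 => Cat.of (Type u)
  | n + 1 => Cat.of (SimplicialObject (NSSet n))

/-- The category `Catⁿ` of `n`-fold categories: `Cat⁰ = Set` and `Catⁿ⁺¹ = Cat(Catⁿ)`. -/
def NCat : ℕ → Cat.{u, u + 1}
  | 0 => Cat.of (Type u)
  | n + 1 => Cat.of (IntCat (NCat n))

/-- The `(n + 1)`-fold category `X` as an internal category in `n`-fold categories. -/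
def NCat.toIntCat {n : ℕ} (X : NCat.{u} (n + 1)) : IntCat (NCat.{u} n) := X

/-- An internal category in `n`-fold categories as an `(n + 1)`-fold category. -/
def NCat.ofIntCat {n : ℕ} (X : IntCat (NCat.{u} n)) : NCat.{u} (n + 1) := X

/-- The `n`-fold category `X_s`, where `s` is put in the first simplicial direction. -/
def NCat.slice {n : ℕ} (X : NCat.{u} (n + 1)) (s : ℕ) : NCat.{u} n :=
  (NCat.toIntCat X).obj.obj (op (.mk s))

/-- The multinerve `N₍ₙ₎ : Catⁿ ⥤ [(Δᵒᵖ)ⁿ, Set]`, `(N₍ₙ₊₁₎ X)_s = N₍ₙ₎ (X_s)`. -/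
def multinerve : (n : ℕ) → (NCat.{u} n ⥤ NSSet.{u} n)
  | 0 => 𝟭 (Type u)
  | n + 1 => (IsSegal (NCat.{u} n)).ι ⋙
      (SimplicialObject.whiskering (NCat.{u} n) (NSSet.{u} n)).obj (multinerve n)

/-- The reindexing of `(n + 1)`-fold simplicial sets that moves the first simplicial direction to
the last place: `(rotate R)(k_1, …, k_n, r) = R(r, k_1, …, k_n)`. -/
def rotate : (n : ℕ) → (NSSet.{u} (n + 1) ⥤ NSSet.{u} (n + 1))
  | 0 => 𝟭 (SimplicialObject (Type u))
  | n + 1 => (flipFunctor SimplexCategoryᵒᵖ SimplexCategoryᵒᵖ (NSSet.{u} n) :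
        SimplicialObject (SimplicialObject (NSSet.{u} n)) ⥤
          SimplicialObject (SimplicialObject (NSSet.{u} n))) ⋙
      (SimplicialObject.whiskering (NSSet.{u} (n + 1)) (NSSet.{u} (n + 1))).obj (rotate n)

/-- `R`, as an internal category in `Catⁿ`, is `ξ X`: the presentation of the `(n + 1)`-fold
category `X` as an internal category in `Catⁿ` along its last simplicial direction, so that
`R_r(k_1, …, k_n) = X(k_1, …, k_n, r)`. -/
def IsXi {n : ℕ} (X : NCat.{u} (n + 1)) (R : IntCat (NCat.{u} n)) : Prop :=
  Nonempty ((multinerve (n + 1)).obj X ≅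
    (rotate n).obj ((multinerve (n + 1)).obj (NCat.ofIntCat R)))

/-- A morphism in the category of sets is a surjective map. -/
def IsSurjective {X Y : Type u} (f : X ⟶ Y) : Prop := Function.Surjective f

/-- A map of `n`-fold simplicial sets is levelwise surjective. -/
def LevelwiseSurjective : (n : ℕ) → {X Y : NSSet.{u} n} → (X ⟶ Y) → Prop
  | 0, X, Y, f => IsSurjective (X := X) (Y := Y) f
  | n + 1, X, Y, f => ∀ s : SimplexCategoryᵒᵖ,
      LevelwiseSurjective n
        (NatTrans.app (C := SimplexCategoryᵒᵖ) (D := NSSet.{u} n) (F := X) (G := Y) f s)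

/-- The functor `p̄` from `(n + 1)`-fold to `n`-fold simplicial sets, which applies levelwise, in the
last direction, the functor `p` of isomorphism classes of objects:
`(p̄ X)_{s_1 … s_n} = p (X_{s_1 … s_n})`. A simplicial set that is the nerve of a category is turned
into that category by Mathlib's `SSet.hoFunctor`, the left adjoint and left inverse of the nerve. -/
def pBar : (n : ℕ) → (NSSet.{u} (n + 1) ⥤ NSSet.{u} n)
  | 0 => (SSet.hoFunctor.{u} ⋙ isomorphismClasses.{u, u} : SSet.{u} ⥤ Type u)
  | n + 1 => (SimplicialObject.whiskering (NSSet.{u} (n + 1)) (NSSet.{u} n)).obj (pBar n)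

/-! ### Homotopically discrete `n`-fold categories and `n`-equivalence relations -/

/-- The simplicial set `S` is the nerve of an equivalence relation, that is, of a (small)
groupoid equivalent to a discrete category. -/
def IsEquivRelation (S : SSet.{u}) : Prop :=
  ∃ (G : Type u) (_ : Groupoid.{u} G), Nonempty (S ≅ nerve G) ∧
    ∃ D : Type u, Nonempty (G ≌ Discrete D)

/-- The homotopically discrete `n`-fold categories. For `n = 1` these are the equivalence
relations. For `n ≥ 2`, an `n`-fold category `X` (a simplicial object in `Catⁿ⁻¹` with invertible
Segal maps) is homotopically discrete if every `X_s` is, and if applying `p` levelwise in the last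
direction of `X` gives the multinerve of a homotopically discrete
`(n - 1)`-fold category `p⁽ⁿ⁾ X`. (For `n = 0` the value is a convention.) -/
def IsHomDiscrete : (n : ℕ) → ObjectProperty (NCat.{u} n)
  | 0 => fun _ => True
  | 1 => fun X => IsEquivRelation (NCat.toIntCat X).obj
  | n + 2 => fun X =>
      (∀ s : ℕ, IsHomDiscrete (n + 1) (NCat.slice X s)) ∧
      ∃ Y : NCat.{u} (n + 1), IsHomDiscrete (n + 1) Y ∧
        Nonempty ((multinerve (n + 1)).obj Y ≅ (pBar (n + 1)).obj ((multinerve (n + 2)).obj X))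

/-- The `n`-equivalence relations. For `n = 1` these are the equivalence relations. For `n ≥ 2` they
are the `n`-fold categories of the form `A[f]`, for `f : A ⟶ Y` a morphism of `(n - 1)`-fold
categories whose multinerve is levelwise surjective and whose target `Y` is an
`(n - 1)`-equivalence relation; the internal category `A[f]` in `Catⁿ⁻¹` is placed in the last
simplicial direction. (For `n = 0` the value is a convention.) -/
def IsNEquivRelation : (n : ℕ) → ObjectProperty (NCat.{u} n)
  | 0 => fun _ => True
  | 1 => fun X => IsEquivRelation (NCat.toIntCat X).obj
  | n + 2 => fun X =>
      ∃ (A Y : NCat.{u} (n + 1)) (f : A ⟶ Y),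
        IsNEquivRelation (n + 1) Y ∧
        LevelwiseSurjective (n + 1) ((multinerve (n + 1)).map f) ∧
        ∃ R : IntCat (NCat.{u} (n + 1)), IsInternalEqRel f R ∧ IsXi X R

/-- The full subcategory `Cat_hdⁿ` of `Catⁿ`. -/
abbrev CatHd (n : ℕ) := (IsHomDiscrete.{u} n).FullSubcategory

/-- The full subcategory `EqRⁿ` of `Catⁿ`. -/
abbrev EqR (n : ℕ) := (IsNEquivRelation.{u} n).FullSubcategory

end NFold

end

/-!
# Homotopically discrete `n`-fold categories are `n`-equivalence relations
-/

noncomputable section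

open Limits

namespace NFold

/-! ### The Segal condition -/

section Segal

universe v₁ w₁ v₂ w₂

variable {C : Type w₁} [Category.{v₁} C] {D : Type w₂} [Category.{v₂} D]

/-! Both conditions express one fact: along its last direction `X` is the kernel pair of a levelwise
surjection `f : A ⟶ Y`, where `Y` satisfies the condition one dimension lower.

If `X` is homotopically discrete, each category in the last direction is an equivalence relation, so
its arrows are the kernel pair of the surjection from objects to isomorphism classes. These
surjections are natural and assemble into `toPBar`, whose target is the multinerve of some `Y`;
fullness of the multinerve turns it into `f`, and induction applies to `Y`. Conversely, if `X` is
`A[f]`, then `X_s` is `A_s[f_s]`, so induction handles the slices (`IsNEquivRelation.slice`). The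
maps `f` and `toPBar` are levelwise surjections with the same kernel pair. Each is the coequalizer
of that pair (`LevelwiseSurjective.nonempty_isColimit`), so `Y` has multinerve `p̄ X`.

To pass between the last direction and the first, the multinerve must be fully faithful and preserve
limits, and its essential image must be stable under `unrotate`. -/

lemma nu_comp_δ_zero (X : SimplicialObject C) {m : ℕ} (i : Fin (m + 1)) :
    nu X i.castSucc ≫ X.δ (0 : Fin 2) = nu X i.succ ≫ X.δ (1 : Fin 2) := by
  unfold nu SimplicialObject.δ
  rw [← X.map_comp, ← X.map_comp, ← op_comp, ← op_comp]
  congr 2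
  ext j
  fin_cases j
  simp [SimplexCategory.mkOfSucc, SimplexCategory.δ]
  rfl

lemma nu_naturality {X Y : SimplicialObject C} (f : X ⟶ Y) {k : ℕ} (j : Fin k) :
    f.app (op (.mk k)) ≫ nu Y j = nu X j ≫ f.app (op (.mk 1)) :=
  (f.naturality _).symm

lemma δ_app_naturality {X Y : SimplicialObject C} (f : X ⟶ Y) {n : ℕ} (i : Fin (n + 2)) :
    f.app (op (.mk (n + 1))) ≫ Y.δ i = X.δ i ≫ f.app (op (.mk n)) :=
  (f.naturality _).symm

/-- The zigzag whose limit is the target of the Segal map. -/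
abbrev zigzagShape (m : ℕ) : MulticospanShape.{0, 0} where
  L := Fin (m + 2)
  R := Fin (m + 1)
  fst := Fin.castSucc
  snd := Fin.succ

/-- The zigzag formed by copies of the two face maps `X_1 ⟶ X_0`. -/
def zigzagIndex (X : SimplicialObject C) (m : ℕ) : MulticospanIndex (zigzagShape m) C where
  left _ := X.obj (op (.mk 1))
  right _ := X.obj (op (.mk 0))
  fst _ := X.δ (0 : Fin 2)
  snd _ := X.δ (1 : Fin 2)

/-- The maps `ν_j : X_{m+2} ⟶ X_1` as a multifork on the zigzag. -/
def segalFork (X : SimplicialObject C) (m : ℕ) : Multifork (zigzagIndex X m) :=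
  Multifork.ofι _ (X.obj (op (.mk (m + 2)))) (fun j => nu X (show Fin (m + 2) from j))
    (fun i => nu_comp_δ_zero X (show Fin (m + 1) from i))

/-- As a limit cone, the Segal condition becomes accessible to preservation and reflection of
limits. -/
lemma IsSegal.nonempty_isLimit {X : SimplicialObject C} (h : IsSegal C X) (m : ℕ) :
    Nonempty (IsLimit (segalFork X m)) :=
  ⟨Multifork.IsLimit.mk _ (fun E => (h m E.pt E.ι E.condition).choose)
    (fun E => (h m E.pt E.ι E.condition).choose_spec.1)
    (fun E k hk => (h m E.pt E.ι E.condition).choose_spec.2 k hk)⟩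

lemma isSegal_of_isLimit {X : SimplicialObject C}
    (h : ∀ m, Nonempty (IsLimit (segalFork X m))) : IsSegal C X := by
  intro m T g hg
  obtain ⟨hl⟩ := h m
  refine ⟨Multifork.IsLimit.lift hl g hg, fun j => Multifork.IsLimit.fac hl g hg j, ?_⟩
  intro k hk
  exact Multifork.IsLimit.hom_ext hl fun j =>
    (hk j).trans (Multifork.IsLimit.fac hl g hg j).symm

lemma IsSegal.comp {X : SimplicialObject C} (h : IsSegal C X) (F : C ⥤ D)
    [PreservesLimitsOfSize.{0, 0} F] :
    IsSegal D (((SimplicialObject.whiskering C D).obj F).obj X) :=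
  isSegal_of_isLimit fun m => by
    obtain ⟨hl⟩ := h.nonempty_isLimit m
    exact ⟨Multifork.isLimitMapOfPreserves _ F hl⟩

lemma isSegal_of_comp {X : SimplicialObject C} (F : C ⥤ D) [F.Full] [F.Faithful]
    (h : IsSegal D (((SimplicialObject.whiskering C D).obj F).obj X)) : IsSegal C X := by
  intro m T g hg
  obtain ⟨k, hk, hu⟩ := h m (F.obj T) (fun j => F.map (g j)) (fun i => by
    have := congrArg F.map (hg i)
    rwa [F.map_comp, F.map_comp] at this)
  obtain ⟨k, rfl⟩ := F.map_surjective (X := T) (Y := X.obj (op (.mk (m + 2)))) k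
  refine ⟨k, fun j => F.map_injective ((F.map_comp _ _).trans (hk j)),
    fun k' hk' => F.map_injective ?_⟩
  · refine hu _ fun j => ?_
    have := congrArg F.map (hk' j)
    rwa [F.map_comp] at this

instance : (IsSegal C).IsClosedUnderIsomorphisms where
  of_iso {X Y} e h := by
    intro m T g hg
    obtain ⟨k, hk, hu⟩ := h m T (fun j => g j ≫ e.inv.app _) (fun i => by
      rw [Category.assoc, Category.assoc, δ_app_naturality, δ_app_naturality,
        reassoc_of% (hg i)])
    refine ⟨k ≫ e.hom.app _, fun j => ?_, fun k' hk' => ?_⟩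
    · rw [Category.assoc, nu_naturality, reassoc_of% (hk j)]
      simp
    · rw [← hu (k' ≫ e.inv.app _) fun j => ?_]
      · simp
      · rw [Category.assoc, nu_naturality, reassoc_of% (hk' j)]

lemma isSegal_of_evaluation {J : Type w} [Category.{v} J] {X : SimplicialObject (J ⥤ D)}
    (h : ∀ j : J, IsSegal D
      (((SimplicialObject.whiskering (J ⥤ D) D).obj ((evaluation J D).obj j)).obj X)) :
    IsSegal (J ⥤ D) X :=
  isSegal_of_isLimit fun m => ⟨evaluationJointlyReflectsLimits _ fun j =>
    (Multifork.isLimitMapEquiv _ _).symm ((h j).nonempty_isLimit m).some⟩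

/-- Limits commute with limits. This gives `IntCat C` limits that are computed on nerves, as needed
for the multinerve to preserve them. -/
instance {J : Type w} [Category.{v} J] [HasLimitsOfShape J C] :
    (IsSegal C).IsClosedUnderLimitsOfShape J where
  limitsOfShape_le := by
    rintro X ⟨p⟩ m T g hg
    let π (j : J) : X ⟶ p.diag.obj j := p.π.app j
    have hl (a : SimplexCategoryᵒᵖ) := isLimitOfPreserves ((evaluation _ C).obj a) p.isLimit
    have key (j : J) := p.prop_diag_obj j m T (fun i => g i ≫ (π j).app _) (fun i => by
      rw [Category.assoc, Category.assoc, δ_app_naturality, δ_app_naturality,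
        reassoc_of% (hg i)])
    choose k hk hu using key
    have hk' (j : J) (i : Fin (m + 2)) : k j ≫ nu (p.diag.obj j) i = g i ≫ (π j).app _ :=
      hk j i
    let c : Cone (p.diag ⋙ (evaluation _ C).obj (op (.mk (m + 2)))) :=
      { pt := T
        π := { app := k
               -- The lifts to the separate factors are compatible by uniqueness in the Segal
               -- condition of the target factor.
               naturality := fun j j' φ => by
                refine (Category.id_comp _).trans (hu j' _ fun i => ?_).symm
                refine (Category.assoc _ _ _).trans ?_
                refine (congrArg (k j ≫ ·) (nu_naturality (p.diag.map φ) i)).trans ?_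
                rw [← Category.assoc, hk', Category.assoc, ← NatTrans.comp_app]
                exact congrArg (fun t => g i ≫ NatTrans.app t _) (p.w φ) } }
    have fac (j : J) : (hl _).lift c ≫ (π j).app _ = k j := (hl _).fac c j
    refine ⟨(hl _).lift c, fun i => (hl _).hom_ext fun j => ?_,
      fun k' hk' => (hl _).hom_ext fun j => ?_⟩
    · change (_ ≫ _) ≫ (π j).app _ = _ ≫ (π j).app _
      rw [Category.assoc, ← nu_naturality, reassoc_of% (fac j)]
      exact hk j i
    · change _ ≫ (π j).app _ = _ ≫ (π j).app _
      rw [fac]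
      refine hu j _ fun i => ?_
      rw [Category.assoc, nu_naturality, reassoc_of% (hk' i)]

end Segal

/-! ### Limits of `n`-fold categories and the image of the multinerve -/

instance hasLimits_nsset : (n : ℕ) → HasLimitsOfSize.{0, 0} (NSSet.{u} n)
  | 0 => inferInstanceAs (HasLimitsOfSize.{0, 0} (Type u))
  | n + 1 =>
    have := hasLimits_nsset n
    inferInstanceAs (HasLimitsOfSize.{0, 0} (SimplexCategoryᵒᵖ ⥤ NSSet.{u} n))

section

universe v₁ w₁ v₂ w₂

variable {C : Type w₁} [Category.{v₁} C] {D : Type w₂} [Category.{v₂} D]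

instance [HasLimitsOfSize.{0, 0} C] : HasLimitsOfSize.{0, 0} (SimplicialObject C) :=
  inferInstanceAs (HasLimitsOfSize.{0, 0} (SimplexCategoryᵒᵖ ⥤ C))

instance [HasLimitsOfSize.{0, 0} C] : HasLimitsOfSize.{0, 0} (IntCat C) where
  has_limits_of_shape _ _ := inferInstance

instance [HasLimitsOfSize.{0, 0} C] : PreservesLimitsOfSize.{0, 0} (IsSegal C).ι where
  preservesLimitsOfShape := inferInstance

instance [HasLimitsOfSize.{0, 0} C] (F : C ⥤ D) [PreservesLimitsOfSize.{0, 0} F] :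
    PreservesLimitsOfSize.{0, 0} ((SimplicialObject.whiskering C D).obj F) where
  preservesLimitsOfShape {J} _ := inferInstanceAs
    (PreservesLimitsOfShape J ((Functor.whiskeringRight SimplexCategoryᵒᵖ C D).obj F))

instance (F : C ⥤ D) [F.Full] [F.Faithful] : ((SimplicialObject.whiskering C D).obj F).Full :=
  ((Functor.FullyFaithful.ofFullyFaithful F).whiskeringRight SimplexCategoryᵒᵖ).full

instance (F : C ⥤ D) [F.Full] [F.Faithful] : ((SimplicialObject.whiskering C D).obj F).Faithful :=
  ((Functor.FullyFaithful.ofFullyFaithful F).whiskeringRight SimplexCategoryᵒᵖ).faithful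

end

instance hasLimits_ncat : (n : ℕ) → HasLimitsOfSize.{0, 0} (NCat.{u} n)
  | 0 => inferInstanceAs (HasLimitsOfSize.{0, 0} (Type u))
  | n + 1 =>
    have := hasLimits_ncat n
    inferInstanceAs (HasLimitsOfSize.{0, 0} (IntCat (NCat.{u} n)))

instance preservesLimits_multinerve :
    (n : ℕ) → PreservesLimitsOfSize.{0, 0} (multinerve.{u} n)
  | 0 => inferInstanceAs (PreservesLimitsOfSize.{0, 0} (𝟭 (Type u)))
  | n + 1 =>
    have := preservesLimits_multinerve n
    inferInstanceAs (PreservesLimitsOfSize.{0, 0} ((IsSegal (NCat.{u} n)).ι ⋙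
      (SimplicialObject.whiskering (NCat.{u} n) (NSSet.{u} n)).obj (multinerve n)))

lemma full_faithful_multinerve : (n : ℕ) → (multinerve.{u} n).Full ∧ (multinerve.{u} n).Faithful
  | 0 => ⟨inferInstanceAs (𝟭 (Type u)).Full, inferInstanceAs (𝟭 (Type u)).Faithful⟩
  | n + 1 =>
    have := (full_faithful_multinerve n).1
    have := (full_faithful_multinerve n).2
    ⟨inferInstanceAs ((IsSegal (NCat.{u} n)).ι ⋙
      (SimplicialObject.whiskering (NCat.{u} n) (NSSet.{u} n)).obj (multinerve n)).Full,
    inferInstanceAs ((IsSegal (NCat.{u} n)).ι ⋙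
      (SimplicialObject.whiskering (NCat.{u} n) (NSSet.{u} n)).obj (multinerve n)).Faithful⟩

instance (n : ℕ) : (multinerve.{u} n).Full := (full_faithful_multinerve n).1

instance (n : ℕ) : (multinerve.{u} n).Faithful := (full_faithful_multinerve n).2

/-- An `(n + 1)`-fold simplicial set is a multinerve if and only if it is a simplicial object in
multinerves whose Segal maps are isomorphisms. -/
lemma essImage_multinerve_succ {n : ℕ} (T : SimplicialObject (NSSet.{u} n)) :
    (multinerve.{u} (n + 1)).essImage T ↔
      (∀ a, (multinerve.{u} n).essImage (T.obj a)) ∧ IsSegal (NSSet.{u} n) T := by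
  constructor
  · rintro ⟨X, ⟨e⟩⟩
    let X' : IntCat (NCat.{u} n) := X
    let e' : ((SimplicialObject.whiskering (NCat.{u} n) (NSSet.{u} n)).obj (multinerve n)).obj
      X'.obj ≅ T := e
    exact ⟨fun a => ⟨X'.obj.obj a, ⟨e'.app a⟩⟩,
      (IsSegal _).prop_of_iso e' (X'.property.comp (multinerve n))⟩
  · rintro ⟨h, hs⟩
    -- A simplicial object whose levels are multinerves lifts along the fully faithful `multinerve
    -- n`, which then reflects the Segal condition.
    let X : SimplicialObject (NCat.{u} n) := Functor.essImage.liftFunctor T (multinerve n) h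
    let e : ((SimplicialObject.whiskering (NCat.{u} n) (NSSet.{u} n)).obj (multinerve n)).obj X ≅
      T := Functor.essImage.liftFunctorCompIso T (multinerve n) h
    let X' : IntCat (NCat.{u} n) :=
      ⟨X, isSegal_of_comp (multinerve n) ((IsSegal _).prop_of_iso e.symm hs)⟩
    exact ⟨X', ⟨e⟩⟩

/-! ### Moving the last simplicial direction to the front -/

/-- The reindexing of `(n + 1)`-fold simplicial sets that moves the last simplicial direction to
the first place; it is inverse to `rotate`. -/
def unrotate : (n : ℕ) → (NSSet.{u} (n + 1) ⥤ NSSet.{u} (n + 1))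
  | 0 => 𝟭 (SimplicialObject (Type u))
  | n + 1 =>
    (SimplicialObject.whiskering (NSSet.{u} (n + 1)) (NSSet.{u} (n + 1))).obj (unrotate n) ⋙
      (flipFunctor SimplexCategoryᵒᵖ SimplexCategoryᵒᵖ (NSSet.{u} n) :
        SimplicialObject (SimplicialObject (NSSet.{u} n)) ⥤
          SimplicialObject (SimplicialObject (NSSet.{u} n)))

/-- Flipping twice is definitionally the identity, so the composites are equal to the identity
functor and not merely isomorphic to it. -/
lemma rotate_comp_unrotate : (n : ℕ) → rotate.{u} n ⋙ unrotate n = 𝟭 _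
  | 0 => rfl
  | n + 1 => by
    change (flipFunctor SimplexCategoryᵒᵖ SimplexCategoryᵒᵖ (NSSet.{u} n) :
        SimplicialObject (SimplicialObject (NSSet.{u} n)) ⥤
          SimplicialObject (SimplicialObject (NSSet.{u} n))) ⋙
      (SimplicialObject.whiskering (NSSet.{u} (n + 1)) (NSSet.{u} (n + 1))).obj
        (rotate n ⋙ unrotate n) ⋙ flipFunctor SimplexCategoryᵒᵖ SimplexCategoryᵒᵖ (NSSet.{u} n) = _
    rw [rotate_comp_unrotate n]
    rfl

lemma unrotate_comp_rotate : (n : ℕ) → unrotate.{u} n ⋙ rotate n = 𝟭 _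
  | 0 => rfl
  | n + 1 => by
    change (SimplicialObject.whiskering (NSSet.{u} (n + 1)) (NSSet.{u} (n + 1))).obj
        (unrotate n ⋙ rotate n) = _
    rw [unrotate_comp_rotate n]
    rfl

lemma unrotate_rotate (n : ℕ) (T : NSSet.{u} (n + 1)) :
    (unrotate n).obj ((rotate n).obj T) = T :=
  Functor.congr_obj (rotate_comp_unrotate n) T

lemma rotate_unrotate (n : ℕ) (T : NSSet.{u} (n + 1)) :
    (rotate n).obj ((unrotate n).obj T) = T :=
  Functor.congr_obj (unrotate_comp_rotate n) T

instance preservesLimits_unrotate : (n : ℕ) → PreservesLimitsOfSize.{0, 0} (unrotate.{u} n)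
  | 0 => inferInstanceAs (PreservesLimitsOfSize.{0, 0} (𝟭 (SimplicialObject (Type u))))
  | n + 1 => by
    have := preservesLimits_unrotate n
    let F : SimplicialObject (NSSet.{u} (n + 1)) ⥤ SimplicialObject (NSSet.{u} (n + 1)) :=
      (SimplicialObject.whiskering (NSSet.{u} (n + 1)) (NSSet.{u} (n + 1))).obj (unrotate n)
    let G : SimplicialObject (NSSet.{u} (n + 1)) ⥤ SimplicialObject (NSSet.{u} (n + 1)) :=
      (Functor.flipping (C := SimplexCategoryᵒᵖ) (D := SimplexCategoryᵒᵖ)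
        (E := NSSet.{u} n)).functor
    have : PreservesLimitsOfSize.{0, 0} F := inferInstance
    have : PreservesLimitsOfSize.{0, 0} G :=
      (Functor.flipping (C := SimplexCategoryᵒᵖ) (D := SimplexCategoryᵒᵖ)
        (E := NSSet.{u} n)).symm.toAdjunction.rightAdjoint_preservesLimits
    exact comp_preservesLimits F G

/-- Multinerves are stable under moving the last simplicial direction to the front. -/
lemma essImage_multinerve_unrotate : (n : ℕ) → (T : NSSet.{u} (n + 1)) →
    (multinerve.{u} (n + 1)).essImage T → (multinerve.{u} (n + 1)).essImage ((unrotate n).obj T)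
  | 0, _, h => h
  | n + 1, T, h => by
    let T' : SimplicialObject (NSSet.{u} (n + 1)) := T
    obtain ⟨h₁, h₂⟩ := (essImage_multinerve_succ T').1 h
    have h₃ (b) := (essImage_multinerve_succ ((unrotate n).obj (T'.obj b))).1
      (essImage_multinerve_unrotate n _ (h₁ b))
    let ev (a : SimplexCategoryᵒᵖ) : NSSet.{u} (n + 1) ⥤ NSSet.{u} n :=
      (evaluation SimplexCategoryᵒᵖ (NSSet.{u} n)).obj a
    have (a : SimplexCategoryᵒᵖ) : PreservesLimitsOfSize.{0, 0} (ev a) :=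
      ⟨fun {_} _ => evaluation_preservesLimitsOfShape (C := NSSet.{u} n) a⟩
    -- Fixing `a` in the new first direction leaves a simplicial object in `b`. Its levels are
    -- multinerves by `h₃`, and its Segal condition is that of `T`, carried along the
    -- limit-preserving `unrotate n ⋙ ev a`. The Segal condition in the direction of `a` is checked
    -- at each `b`.
    refine (essImage_multinerve_succ (n := n + 1) _).2 ⟨fun a =>
      (essImage_multinerve_succ (n := n) _).2 ⟨fun b => (h₃ b).1 a, ?_⟩,
      isSegal_of_evaluation fun b => (h₃ b).2⟩
    exact h₂.comp (unrotate n ⋙ ev a)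

/-! ### Simplicial sets whose edges form a kernel pair -/

section SSet

variable {S : SSet.{u}}

lemma IsSegal.existsUnique_simplex (h : IsSegal (Type u) S) {m : ℕ}
    (g : Fin (m + 2) → S.obj (op (.mk 1)))
    (hg : ∀ i : Fin (m + 1), S.δ (0 : Fin 2) (g i.castSucc) = S.δ (1 : Fin 2) (g i.succ)) :
    ∃! x : S.obj (op (.mk (m + 2))), ∀ j, nu S j x = g j := by
  obtain ⟨k, hk, hu⟩ := h m PUnit (fun j => ↾fun _ => g j) (fun i => by ext; exact hg i)
  refine ⟨k PUnit.unit, fun j => ConcreteCategory.congr_hom (hk j) PUnit.unit, fun y hy => ?_⟩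
  exact ConcreteCategory.congr_hom (hu (↾fun _ => y) fun j => by ext; exact hy j) PUnit.unit

/-- The `i`-th vertex of a simplex. -/
def vertex {k : ℕ} (x : S.obj (op (.mk k))) (i : Fin (k + 1)) : S.obj (op (.mk 0)) :=
  S.map (SimplexCategory.const (.mk 0) (.mk k) i).op x

lemma vertex_map {k l : ℕ} (α : SimplexCategory.mk l ⟶ .mk k) (x : S.obj (op (.mk k)))
    (i : Fin (l + 1)) : vertex (S.map α.op x) i = vertex x (α.toOrderHom i) := by
  unfold vertex
  rw [← ConcreteCategory.comp_apply, ← S.map_comp, ← op_comp, SimplexCategory.const_comp]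

lemma vertex_zero (x : S.obj (op (.mk 0))) : vertex x 0 = x := by
  have : SimplexCategory.const (.mk 0) (.mk 0) 0 = 𝟙 _ := by ext i; fin_cases i; rfl
  unfold vertex
  rw [this]
  simp

lemma δ_one_eq_vertex (x : S.obj (op (.mk 1))) : S.δ (1 : Fin 2) x = vertex x 0 := by
  rw [← vertex_zero (S.δ (1 : Fin 2) x)]
  exact vertex_map _ _ _

lemma δ_zero_eq_vertex (x : S.obj (op (.mk 1))) : S.δ (0 : Fin 2) x = vertex x 1 := by
  rw [← vertex_zero (S.δ (0 : Fin 2) x)]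
  exact vertex_map _ _ _

lemma vertex_nu_zero {k : ℕ} (x : S.obj (op (.mk k))) (j : Fin k) :
    vertex (nu S j x) 0 = vertex x j.castSucc :=
  vertex_map _ _ _

lemma vertex_nu_one {k : ℕ} (x : S.obj (op (.mk k))) (j : Fin k) :
    vertex (nu S j x) 1 = vertex x j.succ :=
  vertex_map _ _ _

variable {B : Type u} {r : S.obj (op (.mk 0)) ⟶ B}

/-- The vertices `i ≤ j` span an edge of `x`, and `r` identifies the two ends of every edge. -/
lemma vertex_eq_of_isPullback (h : IsPullback (S.δ (1 : Fin 2)) (S.δ (0 : Fin 2)) r r) {k : ℕ}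
    (x : S.obj (op (.mk k))) (i j : Fin (k + 1)) : r (vertex x i) = r (vertex x j) := by
  wlog hij : i ≤ j generalizing i j
  · exact (this j i (le_of_not_ge hij)).symm
  have := ConcreteCategory.congr_hom h.w (S.map (SimplexCategory.mkOfLe i j hij).op x)
  simp only [ConcreteCategory.comp_apply] at this
  rw [δ_one_eq_vertex, δ_zero_eq_vertex, vertex_map, vertex_map] at this
  exact this

/-- In a simplicial set with invertible Segal maps whose edges form the kernel pair of `r`, a
simplex is a tuple of vertices in a single fibre of `r`. -/
lemma IsSegal.existsUnique_vertex (hS : IsSegal (Type u) S)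
    (h : IsPullback (S.δ (1 : Fin 2)) (S.δ (0 : Fin 2)) r r) :
    {k : ℕ} → (v : Fin (k + 1) → S.obj (op (.mk 0))) → (∀ i j, r (v i) = r (v j)) →
      ∃! x : S.obj (op (.mk k)), ∀ i, vertex x i = v i
  -- The Segal condition starts in dimension 2. Dimension 0 is immediate and dimension 1 is the
  -- pullback property; above that, edges between consecutive vertices are glued.
  | 0, v, _ => by
    refine ⟨v 0, fun i => ?_, fun y hy => ?_⟩
    · rw [Fin.fin_one_eq_zero i, vertex_zero]
    · rw [← hy 0, vertex_zero]
  | 1, v, hv => by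
    obtain ⟨x, h₀, h₁⟩ := Types.exists_of_isPullback h (v 0) (v 1) (hv 0 1)
    rw [δ_one_eq_vertex] at h₀
    rw [δ_zero_eq_vertex] at h₁
    refine ⟨x, fun i => ?_, fun y hy => Types.ext_of_isPullback h ?_ ?_⟩
    · fin_cases i
      exacts [h₀, h₁]
    · rw [δ_one_eq_vertex, δ_one_eq_vertex, h₀, hy 0]
    · rw [δ_zero_eq_vertex, δ_zero_eq_vertex, h₁, hy 1]
  | m + 2, v, hv => by
    have key (j : Fin (m + 2)) := Types.exists_of_isPullback h (v j.castSucc) (v j.succ) (hv _ _)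
    choose g h₀ h₁ using key
    obtain ⟨x, hx, hu⟩ := hS.existsUnique_simplex g fun i => by
      rw [h₁, h₀, Fin.succ_castSucc]
    refine ⟨x, fun i => ?_, fun y hy => hu y fun j => Types.ext_of_isPullback h ?_ ?_⟩
    · induction i using Fin.cases with
      | zero =>
        have := vertex_nu_zero x 0
        rw [hx, ← δ_one_eq_vertex, h₀] at this
        exact this.symm
      | succ i =>
        rw [← vertex_nu_one, hx, ← δ_zero_eq_vertex, h₁]
    · rw [h₀, δ_one_eq_vertex, vertex_nu_zero, hy]
    · rw [h₁, δ_zero_eq_vertex, vertex_nu_one, hy]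

lemma edge_ext_of_isPullback (h : IsPullback (S.δ (1 : Fin 2)) (S.δ (0 : Fin 2)) r r)
    {x y : S.obj (op (.mk 1))} (h₀ : vertex x 0 = vertex y 0) (h₁ : vertex x 1 = vertex y 1) :
    x = y := by
  refine Types.ext_of_isPullback h ?_ ?_
  · rwa [δ_one_eq_vertex, δ_one_eq_vertex]
  · rwa [δ_zero_eq_vertex, δ_zero_eq_vertex]

/-- The groupoid has the vertices as objects and a unique arrow between two of them exactly when `r`
agrees on them. It is thin, so simplices of its nerve are tuples in one fibre, as they are in `S`.
-/
lemma isEquivRelation_of_isPullback (hS : IsSegal (Type u) S)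
    (h : IsPullback (S.δ (1 : Fin 2)) (S.δ (0 : Fin 2)) r r) : IsEquivRelation S := by
  -- The range replaces `B` because `r` need not be surjective, while `F` has to be essentially
  -- surjective.
  let G := InducedCategory (Discrete (Set.range r))
    (fun x : S.obj (op (.mk 0)) => Discrete.mk (Set.rangeFactorization r x))
  let F : G ⥤ Discrete (Set.range r) := inducedFunctor _
  have hthin : Quiver.IsThin G := fun x y => ⟨fun a b => F.map_injective (Subsingleton.elim _ _)⟩
  have : F.EssSurj := ⟨fun ⟨⟨_, x, hx⟩⟩ => ⟨x, ⟨eqToIso (by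
    apply Discrete.ext; exact Subtype.ext hx)⟩⟩⟩
  have : F.IsEquivalence := {}
  let mor {x y : S.obj (op (.mk 0))} (e : r x = r y) : (show G from x) ⟶ (show G from y) :=
    F.preimage (eqToHom (Discrete.ext (Subtype.ext e)))
  let φ (k : ℕ) (x : S.obj (op (.mk k))) : ComposableArrows G k :=
    { obj := fun i => vertex x i
      map := fun {i j} _ => mor (vertex_eq_of_isPullback h x i j)
      map_id := fun _ => Subsingleton.elim _ _
      map_comp := fun _ _ => Subsingleton.elim _ _ }
  have hφ (k : ℕ) : Function.Bijective (φ k) := by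
    constructor
    · intro x y hxy
      refine (hS.existsUnique_vertex h _ (vertex_eq_of_isPullback h y)).unique (fun i => ?_)
        fun i => rfl
      exact congrArg (fun c : ComposableArrows G k => c.obj i) hxy
    · intro c
      obtain ⟨x, hx, -⟩ := hS.existsUnique_vertex h (fun i => c.obj i) (fun i j => by
        wlog hij : i ≤ j generalizing i j
        · exact (this j i (le_of_not_ge hij)).symm
        · exact congrArg Subtype.val (Discrete.eq_of_hom (F.map (c.map (homOfLE hij)))))
      exact ⟨x, nerve.ext_of_isThin (C := G) (n := op (.mk k)) (funext hx)⟩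
  let e : S ≅ nerve G := NatIso.ofComponents
    (fun a => (Equiv.ofBijective (φ a.unop.len) (hφ a.unop.len)).toIso) (fun {a b} α => by
      refine ConcreteCategory.hom_ext _ _ fun x => ?_
      refine nerve.ext_of_isThin (C := G) (n := b) (funext fun i => ?_)
      exact vertex_map α.unop x i)
  exact ⟨G, inferInstance, ⟨e⟩, Set.range r, ⟨F.asEquivalence⟩⟩

/-- Take for `r` the object part of the equivalence with a discrete category; full faithfulness
makes arrows the pairs with equal image. -/
lemma IsEquivRelation.exists_isPullback (h : IsEquivRelation S) :
    ∃ (D : Type u) (r : S.obj (op (.mk 0)) ⟶ D),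
      IsPullback (S.δ (1 : Fin 2)) (S.δ (0 : Fin 2)) r r := by
  obtain ⟨G, _, ⟨e⟩, D, ⟨E⟩⟩ := h
  have hthin : Quiver.IsThin G :=
    fun x y => ⟨fun a b => E.functor.map_injective (Subsingleton.elim _ _)⟩
  let s : (nerve G).obj (op (.mk 0)) ⟶ D := ↾fun x => (E.functor.obj (x.obj 0)).as
  have hs : IsPullback ((nerve G).δ (1 : Fin 2)) ((nerve G).δ (0 : Fin 2)) s s := by
    rw [Types.isPullback_iff]
    refine ⟨?_, ?_, ?_⟩
    · ext c
      exact Discrete.eq_of_hom (E.functor.map (ComposableArrows.hom c))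
    · rintro c c' ⟨h₁, h₀⟩
      refine nerve.ext_of_isThin (C := G) (n := op (.mk 1)) (funext fun i => ?_)
      change Fin 2 at i
      fin_cases i
      · exact congrArg (fun c : ComposableArrows G 0 => c.obj 0) h₁
      · exact congrArg (fun c : ComposableArrows G 0 => c.obj 0) h₀
    · intro x y hxy
      refine ⟨ComposableArrows.mk₁ (E.functor.preimage (eqToHom (Discrete.ext hxy)) :
        x.obj 0 ⟶ y.obj 0), ?_, ?_⟩
      · exact ComposableArrows.ext₀ rfl
      · exact ComposableArrows.ext₀ rfl
  refine ⟨D, e.hom.app _ ≫ s, hs.of_iso (e.symm.app _) (e.symm.app _) (e.symm.app _) (Iso.refl _)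
    ?_ ?_ ?_ ?_⟩
  · exact (δ_app_naturality e.inv _).symm
  · exact (δ_app_naturality e.inv _).symm
  · simp
  · simp

end SSet

/-! ### The quotient map from objects to isomorphism classes of objects -/

/-- The functor `T ↦ T(-, …, -, 0)` from `(n + 1)`-fold to `n`-fold simplicial sets. -/
abbrev lastObjects (n : ℕ) : NSSet.{u} (n + 1) ⥤ NSSet.{u} n :=
  unrotate n ⋙ (evaluation SimplexCategoryᵒᵖ (NSSet.{u} n)).obj (op (.mk 0))

/-- The isomorphism class, in the homotopy category, of a vertex of a simplicial set. -/
def isoClassMk (S : SSet.{u}) (x : S.obj (op (.mk 0))) :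
    (SSet.hoFunctor ⋙ isomorphismClasses).obj S :=
  Quotient.mk (isIsomorphicSetoid _)
    (SSet.Truncated.HomotopyCategory.mk (V := (SSet.truncation 2).obj S) x)

/-- The natural map from the objects, in the last direction, to their isomorphism classes. -/
def toPBar : (n : ℕ) → (lastObjects.{u} n ⟶ pBar n)
  | 0 =>
    { app := fun S => ↾(isoClassMk S)
      naturality := fun _ _ _ => rfl }
  | n + 1 => (Functor.whiskeringRight SimplexCategoryᵒᵖ (NSSet.{u} (n + 1)) (NSSet.{u} n)).map
      (toPBar n)

lemma isoClassMk_surjective (S : SSet.{u}) : Function.Surjective (isoClassMk S) := by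
  intro y
  obtain ⟨y, rfl⟩ := Quotient.exists_rep y
  obtain ⟨x, rfl⟩ := SSet.Truncated.HomotopyCategory.mk_surjective y
  exact ⟨x, rfl⟩

lemma levelwiseSurjective_toPBar : (n : ℕ) → (T : NSSet.{u} (n + 1)) →
    LevelwiseSurjective n ((toPBar n).app T)
  | 0, S => isoClassMk_surjective S
  | n + 1, T => fun a => levelwiseSurjective_toPBar n
      (Functor.obj (C := SimplexCategoryᵒᵖ) (D := NSSet.{u} (n + 1)) T a)

section SSet

open SSet.Truncated

variable {S : SSet.{u}} {B : Type u} {r : S.obj (op (.mk 0)) ⟶ B}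

/-- Edges exist in both directions between `x` and `y`. Any three composable-shaped edges bound a
2-simplex, so the two edges become mutually inverse in the homotopy category. -/
lemma isoClassMk_eq_of_isPullback (hS : IsSegal (Type u) S)
    (h : IsPullback (S.δ (1 : Fin 2)) (S.δ (0 : Fin 2)) r r) {x y : S.obj (op (.mk 0))}
    (hxy : r x = r y) : isoClassMk S x = isoClassMk S y := by
  let V := (SSet.truncation 2).obj S
  have edge {a b : S.obj (op (.mk 0))} (hab : r a = r b) : Nonempty (Edge (X := V) a b) := by
    obtain ⟨e, h₁, h₀⟩ := Types.exists_of_isPullback h a b hab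
    exact ⟨⟨e, h₁, h₀⟩⟩
  have comp {a b c : S.obj (op (.mk 0))} (f : Edge (X := V) a b) (g : Edge (X := V) b c)
      (k : Edge (X := V) a c) : HomotopyCategory.homMk f ≫ HomotopyCategory.homMk g =
        HomotopyCategory.homMk k := by
    have endpoints {a b : S.obj (op (.mk 0))} (e : Edge (X := V) a b) :
        vertex (S := S) e.edge 0 = a ∧ vertex (S := S) e.edge 1 = b :=
      ⟨(δ_one_eq_vertex (S := S) e.edge).symm.trans e.src_eq,
        (δ_zero_eq_vertex (S := S) e.edge).symm.trans e.tgt_eq⟩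
    have fibre {a b : S.obj (op (.mk 0))} (e : Edge (X := V) a b) : r a = r b := by
      exact (congrArg r (endpoints e).1).symm.trans
        ((vertex_eq_of_isPullback h e.edge 0 1).trans (congrArg r (endpoints e).2))
    obtain ⟨σ, hσ, -⟩ := hS.existsUnique_vertex h ![a, b, c] (by
      intro i j
      fin_cases i <;> fin_cases j <;> simp [fibre f, fibre g])
    refine HomotopyCategory.homMk_comp_homMk ⟨σ, ?_, ?_, ?_⟩
    · exact edge_ext_of_isPullback h ((vertex_map _ _ _).trans ((hσ 0).trans (endpoints f).1.symm))
        ((vertex_map _ _ _).trans ((hσ 1).trans (endpoints f).2.symm))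
    · exact edge_ext_of_isPullback h ((vertex_map _ _ _).trans ((hσ 1).trans (endpoints g).1.symm))
        ((vertex_map _ _ _).trans ((hσ 2).trans (endpoints g).2.symm))
    · exact edge_ext_of_isPullback h ((vertex_map _ _ _).trans ((hσ 0).trans (endpoints k).1.symm))
        ((vertex_map _ _ _).trans ((hσ 2).trans (endpoints k).2.symm))
  obtain ⟨e⟩ := edge hxy
  obtain ⟨e'⟩ := edge hxy.symm
  refine Quotient.sound ⟨⟨HomotopyCategory.homMk e, HomotopyCategory.homMk e', ?_, ?_⟩⟩
  · exact (comp e e' (Edge.id (X := V) x)).trans (HomotopyCategory.homMk_id _)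
  · exact (comp e' e (Edge.id (X := V) y)).trans (HomotopyCategory.homMk_id _)

/-- Being constant along edges, `r` extends to a functor from the homotopy category to a discrete
category, where isomorphic objects are equal. -/
lemma eq_of_isoClassMk_eq (hw : S.δ (1 : Fin 2) ≫ r = S.δ (0 : Fin 2) ≫ r)
    {x y : S.obj (op (.mk 0))} (hxy : isoClassMk S x = isoClassMk S y) : r x = r y := by
  let V := (SSet.truncation 2).obj S
  let F : V.HomotopyCategory ⥤ Discrete B := HomotopyCategory.lift
    (fun x => Discrete.mk (r x))
    (fun {x y} e => Discrete.eqToHom (by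
      have := ConcreteCategory.congr_hom hw e.edge
      have h₁ : S.δ (1 : Fin 2) e.edge = x := e.src_eq
      have h₀ : S.δ (0 : Fin 2) e.edge = y := e.tgt_eq
      exact (congrArg r h₁).symm.trans (this.trans (congrArg r h₀))))
    (fun _ => Subsingleton.elim _ _) (fun _ => Subsingleton.elim _ _)
  obtain ⟨i⟩ := Quotient.exact hxy
  exact Discrete.eq_of_hom (F.map i.hom)

lemma isPullback_isoClassMk (hS : IsSegal (Type u) S)
    (h : IsPullback (S.δ (1 : Fin 2)) (S.δ (0 : Fin 2)) r r) :
    IsPullback (S.δ (1 : Fin 2)) (S.δ (0 : Fin 2)) (↾(isoClassMk S)) (↾(isoClassMk S)) := by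
  rw [Types.isPullback_iff]
  refine ⟨?_, fun x y hxy => Types.ext_of_isPullback h hxy.1 hxy.2, fun x y hxy =>
    Types.exists_of_isPullback h x y (eq_of_isoClassMk_eq h.w hxy)⟩
  ext e
  exact isoClassMk_eq_of_isPullback hS h (ConcreteCategory.congr_hom h.w e)

end SSet

/-- The `(n + 1)`-fold simplicial set is, in the last direction, levelwise the nerve of an
equivalence relation. -/
def IsLevelwiseEquivRelation : (n : ℕ) → NSSet.{u} (n + 1) → Prop
  | 0, S => IsSegal (Type u) S ∧ ∃ (B : Type u) (r : (lastObjects 0).obj S ⟶ B),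
      IsPullback (SimplicialObject.δ (C := Type u) S (1 : Fin 2))
        (SimplicialObject.δ (C := Type u) S (0 : Fin 2)) r r
  | n + 1, T => ∀ a, IsLevelwiseEquivRelation n
      (Functor.obj (C := SimplexCategoryᵒᵖ) (D := NSSet.{u} (n + 1)) T a)

/-- The maps `r` of the hypothesis are chosen level by level with no compatibility. Replacing them
by the natural `toPBar` gives pullbacks that assemble. -/
lemma IsLevelwiseEquivRelation.isPullback_toPBar : {n : ℕ} → {T : NSSet.{u} (n + 1)} →
    IsLevelwiseEquivRelation n T →
      IsPullback (SimplicialObject.δ (C := NSSet.{u} n) ((unrotate n).obj T) (1 : Fin 2))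
        (SimplicialObject.δ (C := NSSet.{u} n) ((unrotate n).obj T) (0 : Fin 2))
        ((toPBar n).app T) ((toPBar n).app T)
  | 0, _, ⟨hS, _, _, h⟩ => isPullback_isoClassMk hS h
  | _ + 1, _, h => IsPullback.of_forall_isPullback_app fun a => (h a).isPullback_toPBar

lemma isLevelwiseEquivRelation_of_isPullback : {n : ℕ} → {T : NSSet.{u} (n + 1)} →
    (multinerve (n + 1)).essImage T → {B : NSSet.{u} n} → {r : (lastObjects n).obj T ⟶ B} →
      IsPullback (SimplicialObject.δ (C := NSSet.{u} n) ((unrotate n).obj T) (1 : Fin 2))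
        (SimplicialObject.δ (C := NSSet.{u} n) ((unrotate n).obj T) (0 : Fin 2)) r r →
      IsLevelwiseEquivRelation n T
  | 0, _, hT, _, _, h => ⟨((essImage_multinerve_succ _).1 hT).2, _, _, h⟩
  | _ + 1, _, hT, _, _, h => fun a => isLevelwiseEquivRelation_of_isPullback
      (((essImage_multinerve_succ _).1 hT).1 a) (h.app a)

/-! ### Levelwise surjections -/

lemma IsSurjective.comp_iso {X Y Z : Type u} {f : X ⟶ Y} (h : IsSurjective f) (e : Y ≅ Z) :
    IsSurjective (f ≫ e.hom) :=
  e.toEquiv.surjective.comp h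

lemma IsSurjective.iso_comp {X Y Z : Type u} {f : Y ⟶ Z} (h : IsSurjective f) (e : X ≅ Y) :
    IsSurjective (e.hom ≫ f) :=
  Function.Surjective.comp (g := f) h e.toEquiv.surjective

lemma LevelwiseSurjective.comp_iso : {n : ℕ} → {X Y Z : NSSet.{u} n} → {f : X ⟶ Y} →
    LevelwiseSurjective n f → (e : Y ≅ Z) → LevelwiseSurjective n (f ≫ e.hom)
  | 0, _, _, _, _, h, e => IsSurjective.comp_iso h e
  | n + 1, _, _, _, _, h, e => fun a => (h a).comp_iso
      (Iso.app (C := SimplexCategoryᵒᵖ) (D := NSSet.{u} n) e a)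

lemma LevelwiseSurjective.iso_comp : {n : ℕ} → {X Y Z : NSSet.{u} n} → {f : Y ⟶ Z} →
    LevelwiseSurjective n f → (e : X ≅ Y) → LevelwiseSurjective n (e.hom ≫ f)
  | 0, _, _, _, _, h, e => IsSurjective.iso_comp h e
  | n + 1, _, _, _, _, h, e => fun a => (h a).iso_comp
      (Iso.app (C := SimplexCategoryᵒᵖ) (D := NSSet.{u} n) e a)

lemma nonempty_isColimit_of_surjective {P X Y : Type u} {a b : P ⟶ X} {f : X ⟶ Y}
    (hf : Function.Surjective f) (h : IsPullback a b f f) :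
    Nonempty (IsColimit (Cofork.ofπ f h.w)) := by
  have key (s : Cofork a b) {x y : X} (hxy : f x = f y) : s.π x = s.π y := by
    obtain ⟨p, rfl, rfl⟩ := Types.exists_of_isPullback h x y hxy
    exact ConcreteCategory.congr_hom s.condition p
  refine ⟨Cofork.IsColimit.mk _ (fun s => ↾fun y => s.π (Function.surjInv hf y))
    (fun s => ?_) (fun s m hm => ?_)⟩
  · ext x
    exact key s (Function.surjInv_eq hf _)
  · ext y
    obtain ⟨x, rfl⟩ := hf y
    exact (ConcreteCategory.congr_hom hm x).trans (key s (Function.surjInv_eq hf _)).symm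

/-- A levelwise surjection is the coequalizer of its kernel pair. -/
lemma LevelwiseSurjective.nonempty_isColimit : {n : ℕ} → {P X Y : NSSet.{u} n} →
    {a b : P ⟶ X} → {f : X ⟶ Y} → LevelwiseSurjective n f → (h : IsPullback a b f f) →
      Nonempty (IsColimit (Cofork.ofπ f h.w))
  | 0, _, _, _, _, _, _, hf, h => nonempty_isColimit_of_surjective hf h
  | n + 1, _, _, _, _, _, _, hf, h => by
    have key (s : SimplexCategoryᵒᵖ) := (hf s).nonempty_isColimit (h.app s)
    refine ⟨evaluationJointlyReflectsColimits _ fun s => ?_⟩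
    exact (isColimitMapCoconeCoforkEquiv ((evaluation SimplexCategoryᵒᵖ (NSSet.{u} n)).obj s)
      _).symm (key s).some

/-! ### Comparison of the two notions -/

/-- The functor `X ↦ X_s`. -/
def sliceFunctor (n s : ℕ) : NCat.{u} (n + 1) ⥤ NCat.{u} n :=
  (IsSegal (NCat.{u} n)).ι ⋙ (evaluation SimplexCategoryᵒᵖ (NCat.{u} n)).obj (op (.mk s))

instance (n s : ℕ) : PreservesLimitsOfSize.{0, 0} (sliceFunctor.{u} n s) :=
  have : PreservesLimitsOfSize.{0, 0}
      ((evaluation SimplexCategoryᵒᵖ (NCat.{u} n)).obj (op (.mk s))) :=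
    ⟨fun {_} _ => evaluation_preservesLimitsOfShape (C := NCat.{u} n) _⟩
  have : PreservesLimitsOfSize.{0, 0} (IsSegal (NCat.{u} n)).ι := inferInstance
  comp_preservesLimits (C := IntCat (NCat.{u} n)) (D := SimplicialObject (NCat.{u} n))
    (IsSegal (NCat.{u} n)).ι _

lemma isSegal_multinerve_one (X : NCat.{u} 1) : IsSegal (Type u) ((multinerve 1).obj X) :=
  ((essImage_multinerve_succ (n := 0) _).1 ((multinerve 1).obj_mem_essImage X)).2

lemma IsHomDiscrete.isLevelwiseEquivRelation : {n : ℕ} → {X : NCat.{u} (n + 1)} →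
    IsHomDiscrete (n + 1) X → IsLevelwiseEquivRelation n ((multinerve (n + 1)).obj X)
  | 0, X, h => ⟨isSegal_multinerve_one X, IsEquivRelation.exists_isPullback h⟩
  | _ + 1, _, h => fun a => (h.1 a.unop.len).isLevelwiseEquivRelation

lemma isPullback_of_iso_of_isPullback {C : Type w} [Category.{v} C] {P X Y P' X' Y' : C}
    {a b : P ⟶ X} {f : X ⟶ Y} (h : IsPullback a b f f) {a' b' : P' ⟶ X'} {f' : X' ⟶ Y'}
    (p : P' ≅ P) (x : X' ≅ X) (y : Y' ≅ Y) (ha : a' ≫ x.hom = p.hom ≫ a)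
    (hb : b' ≫ x.hom = p.hom ≫ b) (hf : f' ≫ y.hom = x.hom ≫ f) : IsPullback a' b' f' f' := by
  refine h.of_iso p.symm x.symm x.symm y.symm ?_ ?_ ?_ ?_
  · rw [Iso.symm_hom, Iso.symm_hom, Iso.comp_inv_eq, Category.assoc, ha, Iso.inv_hom_id_assoc]
  · rw [Iso.symm_hom, Iso.symm_hom, Iso.comp_inv_eq, Category.assoc, hb, Iso.inv_hom_id_assoc]
  · rw [Iso.symm_hom, Iso.symm_hom, Iso.comp_inv_eq, Category.assoc, hf, Iso.inv_hom_id_assoc]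
  · rw [Iso.symm_hom, Iso.symm_hom, Iso.comp_inv_eq, Category.assoc, hf, Iso.inv_hom_id_assoc]

/-- If the internal category `A[f]` presents `X` along the last direction, then the arrows of the
multinerve of `X` in the last direction form a kernel pair of a map isomorphic to `f`. -/
lemma IsXi.exists_isPullback {n : ℕ} {X : NCat.{u} (n + 1)} {R : IntCat (NCat.{u} n)}
    (hX : IsXi X R) {A Y : NCat.{u} n} {f : A ⟶ Y} (hR : IsInternalEqRel f R) :
    ∃ g : (lastObjects n).obj ((multinerve (n + 1)).obj X) ⟶ (multinerve n).obj Y,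
      IsPullback
        (SimplicialObject.δ (C := NSSet.{u} n) ((unrotate n).obj ((multinerve (n + 1)).obj X))
          (1 : Fin 2))
        (SimplicialObject.δ (C := NSSet.{u} n) ((unrotate n).obj ((multinerve (n + 1)).obj X))
          (0 : Fin 2)) g g ∧
      (LevelwiseSurjective n ((multinerve n).map f) → LevelwiseSurjective n g) := by
  obtain ⟨i⟩ := hX
  obtain ⟨e, he⟩ := hR
  let U : SimplicialObject (NSSet.{u} n) := (unrotate n).obj ((multinerve (n + 1)).obj X)
  let V : SimplicialObject (NSSet.{u} n) :=
    ((SimplicialObject.whiskering (NCat.{u} n) (NSSet.{u} n)).obj (multinerve n)).obj R.obj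
  let j : U ≅ V := (unrotate n).mapIso i ≪≫ eqToIso (unrotate_rotate n _)
  let k : U.obj (op (.mk 0)) ≅ (multinerve n).obj A := j.app _ ≪≫ (multinerve n).mapIso e
  have hk (d : Fin 2) : U.δ d ≫ k.hom =
      (j.app (op (.mk 1))).hom ≫ (multinerve n).map (R.obj.δ d ≫ e.hom) := by
    rw [Functor.map_comp]
    exact ((Category.assoc _ _ _).symm.trans
      (congrArg (· ≫ (multinerve n).map e.hom) (δ_app_naturality j.hom d).symm)).trans
        (Category.assoc _ _ _)
  refine ⟨k.hom ≫ (multinerve n).map f, ?_, fun h => h.iso_comp k⟩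
  exact isPullback_of_iso_of_isPullback (he.map (multinerve n)) (j.app (op (.mk 1))) k
    (Iso.refl _) (hk 1) (hk 0) (Category.comp_id _)

/-- Evaluation at `s` preserves pullbacks, so it sends `A[f]` to `A_s[f_s]`, and `Y_s` is covered by
recursion. In the base case `Y_s` is only a set, so `X_s` is recognised directly as the nerve of an
equivalence relation. -/
lemma IsNEquivRelation.slice : {n : ℕ} → {X : NCat.{u} (n + 2)} → IsNEquivRelation (n + 2) X →
    (s : ℕ) → IsNEquivRelation (n + 1) (NCat.slice X s)
  | 0, X, ⟨_, _, _, _, _, _, hR, hX⟩, s => by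
    obtain ⟨g, hg, -⟩ := hX.exists_isPullback hR
    obtain ⟨h₁, _, _, h₂⟩ := isLevelwiseEquivRelation_of_isPullback
      ((multinerve 2).obj_mem_essImage X) hg (op (.mk s))
    exact isEquivRelation_of_isPullback h₁ h₂
  | n + 1, X, ⟨A, Y, f, hY, hf, R, ⟨e, he⟩, ⟨i⟩⟩, s => by
    let R' : IntCat (NCat.{u} (n + 1)) :=
      ⟨((SimplicialObject.whiskering _ _).obj (sliceFunctor (n + 1) s)).obj R.obj,
        R.property.comp _⟩
    refine ⟨NCat.slice A s, NCat.slice Y s, (sliceFunctor (n + 1) s).map f, hY.slice s,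
      hf (op (.mk s)), R',
      ⟨(sliceFunctor (n + 1) s).mapIso e, ?_⟩,
      ⟨Iso.app (C := SimplexCategoryᵒᵖ) (D := NSSet.{u} (n + 2)) i (op (.mk s))⟩⟩
    have := he.map (sliceFunctor (n + 1) s)
    rw [Functor.map_comp, Functor.map_comp] at this
    exact this

lemma isNEquivRelation_of_isHomDiscrete {n : ℕ}
    (ih : ∀ Y : NCat.{u} (n + 1), IsHomDiscrete (n + 1) Y → IsNEquivRelation (n + 1) Y)
    {X : NCat.{u} (n + 2)} (h : IsHomDiscrete (n + 2) X) : IsNEquivRelation (n + 2) X := by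
  have hX := h.isLevelwiseEquivRelation.isPullback_toPBar
  obtain ⟨-, Y, hY, ⟨y⟩⟩ := h
  obtain ⟨R, ⟨i⟩⟩ := essImage_multinerve_unrotate _ _ ((multinerve (n + 2)).obj_mem_essImage X)
  let R' : IntCat (NCat.{u} (n + 1)) := R
  let A : NCat.{u} (n + 1) := R'.obj.obj (op (.mk 0))
  let U : SimplicialObject (NSSet.{u} (n + 1)) :=
    (unrotate (n + 1)).obj ((multinerve (n + 2)).obj X)
  let V : SimplicialObject (NSSet.{u} (n + 1)) :=
    ((SimplicialObject.whiskering (NCat.{u} (n + 1)) (NSSet.{u} (n + 1))).obj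
      (multinerve (n + 1))).obj R'.obj
  let i' : V ≅ U := i
  let i₀ : (multinerve (n + 1)).obj A ≅ U.obj (op (.mk 0)) := i'.app _
  let q : U.obj (op (.mk 0)) ⟶ (pBar (n + 1)).obj ((multinerve (n + 2)).obj X) :=
    (toPBar (n + 1)).app ((multinerve (n + 2)).obj X)
  -- Fullness of the multinerve turns the quotient map into a morphism of `(n + 1)`-fold categories.
  obtain ⟨f, hf⟩ := (multinerve (n + 1)).map_surjective (X := A) (Y := Y)
    (i₀.hom ≫ q ≫ y.inv)
  have hq : LevelwiseSurjective (n + 1) q := levelwiseSurjective_toPBar _ _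
  refine ⟨A, Y, f, ih Y hY, ?_, R', ⟨Iso.refl _, ?_⟩, ⟨?_⟩⟩
  · rw [hf]
    exact (hq.comp_iso y.symm).iso_comp i₀
  · rw [Iso.refl_hom, Category.comp_id, Category.comp_id]
    have key : IsPullback ((multinerve (n + 1)).map (R'.obj.δ (1 : Fin 2)))
        ((multinerve (n + 1)).map (R'.obj.δ (0 : Fin 2)))
        ((multinerve (n + 1)).map f) ((multinerve (n + 1)).map f) :=
      isPullback_of_iso_of_isPullback hX (i'.app (op (.mk 1))) i₀ y
        (δ_app_naturality i'.hom 1).symm (δ_app_naturality i'.hom 0).symm (by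
          rw [hf, Category.assoc, Category.assoc, y.inv_hom_id, Category.comp_id])
    -- The fully faithful multinerve reflects the kernel pair back to `(n + 1)`-fold categories.
    refine IsPullback.of_map (multinerve.{u} (n + 1)) ((multinerve (n + 1)).map_injective ?_) key
    rw [Functor.map_comp, Functor.map_comp]
    exact key.w
  · exact eqToIso (rotate_unrotate (n + 1) _).symm ≪≫ (rotate (n + 1)).mapIso i.symm

lemma isHomDiscrete_of_isNEquivRelation {n : ℕ}
    (ih : ∀ Y : NCat.{u} (n + 1), IsNEquivRelation (n + 1) Y → IsHomDiscrete (n + 1) Y)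
    {X : NCat.{u} (n + 2)} (h : IsNEquivRelation (n + 2) X) : IsHomDiscrete (n + 2) X := by
  refine ⟨fun s => ih _ (h.slice s), ?_⟩
  obtain ⟨A, Y, f, hY, hf, R, hR, hX⟩ := h
  obtain ⟨g, hg, hgs⟩ := hX.exists_isPullback hR
  have hq := (isLevelwiseEquivRelation_of_isPullback
    ((multinerve (n + 2)).obj_mem_essImage X) hg).isPullback_toPBar
  -- `g` and `toPBar` are both coequalizers of the same two face maps, hence have isomorphic
  -- targets.
  obtain ⟨c⟩ := (hgs hf).nonempty_isColimit hg
  obtain ⟨d⟩ := (levelwiseSurjective_toPBar _ _).nonempty_isColimit hq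
  exact ⟨Y, ih Y hY, ⟨c.coconePointUniqueUpToIso d⟩⟩

lemma isNEquivRelation_iff_isHomDiscrete : (n : ℕ) → (X : NCat.{u} (n + 1)) →
    (IsNEquivRelation (n + 1) X ↔ IsHomDiscrete (n + 1) X)
  | 0, _ => Iff.rfl
  | n + 1, _ =>
    ⟨isHomDiscrete_of_isNEquivRelation fun Y => (isNEquivRelation_iff_isHomDiscrete n Y).1,
      isNEquivRelation_of_isHomDiscrete fun Y => (isNEquivRelation_iff_isHomDiscrete n Y).2⟩

end NFold
end

/-- The categories of `n`-equivalence relations and of homotopically discrete `n`-fold categories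
are isomorphic, over the category of `n`-fold categories of which both are full subcategories. -/
theorem mainTheorem1 (n : ℕ) (hn : 1 ≤ n) :
    ∃ e : Cat.of (NFold.EqR.{u} n) ≅ Cat.of (NFold.CatHd.{u} n),
      e.hom.toFunctor ⋙ (NFold.IsHomDiscrete.{u} n).ι = (NFold.IsNEquivRelation.{u} n).ι := by
  obtain ⟨n, rfl⟩ := Nat.exists_eq_add_of_le' hn
  -- The two properties of `(n + 1)`-fold categories are equal, so the isomorphism is the identity.
  have h : NFold.IsNEquivRelation.{u} (n + 1) = NFold.IsHomDiscrete.{u} (n + 1) :=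
    funext fun X => propext (NFold.isNEquivRelation_iff_isHomDiscrete n X)
  unfold NFold.EqR NFold.CatHd
  rw [h]
  exact ⟨Iso.refl _, rfl⟩
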